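/- Let $\mathbb T=\mathbb R/2\pi\mathbb Z$, let $\|f\|_p$ be the $L^p(\mathbb T)$ norm with respect to $dx/2\pi$, and let $\widehat f(k)=\frac1{2\pi}\int_{\mathbb T}f(x)e^{-ikx}\,dx$. Functions on $\mathbb T$ may be real or complex valued, and convolution is normalised by $\frac1{2\pi}$, so that it multiplies Fourier coefficients. Call a $C^2$ function $\psi:\mathbb R\to\mathbb R$ of monotone type if there are constants $R>0$ and $c_0>0$ such that $|\psi(x)|\ge c_0|\psi(y)|$ and $|\psi''(x)|\ge c_0|\psi''(y)|$ for all $x,y$ with $|x|,|y|\ge R$ and $|y|/2\le|x|\le 2|y|$. For $m\in\mathbb N$, $m\ge1$, put $$J_m(\psi)=\int_{|x|\ge m}\Big(\Big|\frac{\psi(x)}m\Big|+|x\,\psi''(x)|\Big)dx\in[0,\infty].$$ Let $\lambda:\mathbb R\to\mathbb R\setminus\{0\}$ be bounded, put $\varphi_\lambda=\sum_{k\in\mathbb Z}\lambda(k)e^{ikx}$ (a periodic distribution), and for $1\le p\le\infty$ let $$\mathcal H_{\lambda,p}(\mathbb T)=\{f\in L^p(\mathbb T): f=\varphi_\lambda*g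 \text{ for some } g\in L^p(\mathbb T)\},\qquad \|f\|_{\mathcal H_{\lambda,p}(\mathbb T)}=\|g\|_p .$$ Fix a $C^2$ function $\vartheta:\mathbb R\to\mathbb R$ with $\vartheta=1$ on $[-\frac12,\frac12]$ and $\vartheta=0$ outside $(-1,1)$. For $f=\varphi_\lambda*g$ put $$V_m(g)=H_m*g,\quad H_m(x)=\sum_{k\in\mathbb Z}\vartheta(k/m)e^{ikx},\qquad Q_{m,\lambda}(f)=\frac1{2m+1}\sum_{l=0}^{2m}V_m(g)\Big(\frac{2\pi l}{2m+1}\Big)\,\varphi_\lambda\Big(\cdot-\frac{2\pi l}{2m+1}\Big).$$ Suppose that $\lambda$ is of monotone type and $1\le p\le\infty$. Then there is a constant $c>0$, independent of $f$ and $m$, such that for all $f\in\mathcal H_{\lambda,p}(\mathbb T)$ and all integers $m\ge1$, $$\|f-Q_{m,\lambda}(f)\|_p\le c\,J_m(\lambda)\,\|f\|_{\mathcal H_{\lambda,p}(\mathbb T)} .$$ Here the norm of a distribution that is not given by a function in $L^p(\mathbb T)$ is $+\infty$, and $\infty\cdot0=0$. -/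

import Mathlib

noncomputable section

open MeasureTheory
open scoped ENNReal

namespace TorusApprox

/-- The length `2π` of the circle is positive (needed for the normalised measure below). -/
instance twoPiPos : Fact (0 < 2 * Real.pi) := ⟨Real.two_pi_pos⟩

/-- The torus `𝕋 = ℝ / 2πℤ`. -/
abbrev Torus : Type := AddCircle (2 * Real.pi)

/-- The normalised measure `dx / 2π` on the torus. With it,
`eLpNorm f p torusMeasure = ((2π)⁻¹ ∫ |f|^p)^(1/p)` for finite `p`, and the essential supremum
of `|f|` for `p = ∞`. -/
abbrev torusMeasure : Measure Torus := AddCircle.haarAddCircle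

/-- Distributions on the torus, identified with their formal Fourier series
`∑ₖ T k e^{ikx}`. -/
abbrev Distr : Type := ℤ → ℂ

/-- The distribution of an integrable function: the sequence of its Fourier coefficients
`(2π)⁻¹ ∫ u(x) e^{-ikx} dx`. -/
def ofFun (u : Torus → ℂ) : Distr := fun k => fourierCoeff u k

/-- The (normalised) convolution of distributions: Fourier coefficients are multiplied. -/
def conv (S T : Distr) : Distr := fun k => S k * T k

/-- The translate `T(· - y)` of a distribution. -/
def translate (y : Torus) (T : Distr) : Distr := fun k => fourier k (-y) * T k

/-- The `L^p` norm of a distribution: the norm of the (a.e. unique) function in `L^p` that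
it is given by, and `∞` if there is no such function. -/
def distrNorm (p : ℝ≥0∞) (T : Distr) : ℝ≥0∞ :=
  ⨅ (u : Torus → ℂ) (_ : MemLp u p torusMeasure) (_ : ofFun u = T), eLpNorm u p torusMeasure

/-- `φ_ψ = ∑ₖ ψ(k) e^{ikx}`. -/
def phi (ψ : ℝ → ℝ) : Distr := fun k => ((ψ (k : ℝ) : ℝ) : ℂ)

/-- `f = φ_lam * g` with `g ∈ L^p`. -/
def Represents (lam : ℝ → ℝ) (p : ℝ≥0∞) (f g : Torus → ℂ) : Prop :=
  MemLp g p torusMeasure ∧ ofFun f = conv (phi lam) (ofFun g)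

/-- The subspace `H_{lam,p}(𝕋)` of `L^p(𝕋)`. -/
def hSpace (lam : ℝ → ℝ) (p : ℝ≥0∞) : Set (Torus → ℂ) :=
  {f | MemLp f p torusMeasure ∧ ∃ g, Represents lam p f g}

/-- The norm of `H_{lam,p}(𝕋)`: `‖f‖ = ‖g‖_p` where `f = φ_lam * g`. (If `lam` does not vanish,
`g` is a.e. unique, and the infimum runs over a single value.) -/
def hNorm (lam : ℝ → ℝ) (p : ℝ≥0∞) (f : Torus → ℂ) : ℝ≥0∞ :=
  ⨅ (g : Torus → ℂ) (_ : Represents lam p f g), eLpNorm g p torusMeasure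

/-- A twice continuously differentiable cut-off function which is `1` on `[-1/2, 1/2]` and `0`
outside `(-1, 1)`. -/
structure IsCutoff (θ : ℝ → ℝ) : Prop where
  contDiff : ContDiff ℝ 2 θ
  eq_one : ∀ x ∈ Set.Icc (-(1 / 2) : ℝ) (1 / 2), θ x = 1
  eq_zero : ∀ x, x ∉ Set.Ioo (-1 : ℝ) 1 → θ x = 0

/-- The trigonometric polynomial `H_m(x) = ∑ₖ θ(k/m) 𝒢(k) e^{ikx}`, `𝒢 = lam / bet`
(finitely many nonzero terms when `θ` is a cut-off function and `m ≥ 1`). -/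
def kernelH (lam bet θ : ℝ → ℝ) (m : ℕ) (x : Torus) : ℂ :=
  ∑' k : ℤ, ((θ ((k : ℝ) / (m : ℝ)) * (lam k / bet k) : ℝ) : ℂ) * fourier k x

/-- `V_m(g) = H_m * g`, with the normalised convolution. -/
def opV (lam bet θ : ℝ → ℝ) (m : ℕ) (g : Torus → ℂ) (x : Torus) : ℂ :=
  ∫ t, kernelH lam bet θ m (x - t) * g t ∂torusMeasure

/-- The node `2πl/(2m+1)`. -/
def node (m l : ℕ) : Torus := ((2 * Real.pi * (l : ℝ) / (2 * (m : ℝ) + 1) : ℝ) : Torus)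

/-- `Q_{m,bet}(f)` for `f = φ_lam * g`, as a function of `g`: the combination
`(2m+1)⁻¹ ∑_{l=0}^{2m} V_m(g)(x_l) φ_bet(· - x_l)` of translates at the nodes `x_l`. -/
def opQ (lam bet θ : ℝ → ℝ) (m : ℕ) (g : Torus → ℂ) : Distr :=
  (1 / (2 * (m : ℂ) + 1)) •
    ∑ l ∈ Finset.range (2 * m + 1),
      opV lam bet θ m g (node m l) • translate (node m l) (phi bet)

/-- Functions of monotone type. The comparison of the values of `ψ` and of `ψ''` at points of
comparable modulus is required away from a neighbourhood `(-R, R)` of the origin. -/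
def IsMonotoneType (ψ : ℝ → ℝ) : Prop :=
  ContDiff ℝ 2 ψ ∧ ∃ R > 0, ∃ c₀ > 0, ∀ x y : ℝ, R ≤ |x| → R ≤ |y| →
    |x| ≤ 2 * |y| → |y| / 2 ≤ |x| →
      c₀ * |ψ y| ≤ |ψ x| ∧ c₀ * |iteratedDeriv 2 ψ y| ≤ |iteratedDeriv 2 ψ x|

/-- `J_m(ψ) = ∫_{|x| ≥ m} (|ψ(x)/m| + |x ψ''(x)|) dx`, possibly infinite. -/
def functionalJ (m : ℕ) (ψ : ℝ → ℝ) : ℝ≥0∞ :=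
  ∫⁻ x in {x : ℝ | (m : ℝ) ≤ |x|},
    ENNReal.ofReal (|ψ x / (m : ℝ)| + |x * iteratedDeriv 2 ψ x|)

end TorusApprox

end

noncomputable section

open MeasureTheory
open scoped ENNReal

namespace TorusApprox

/-! Sampling at `2m+1` nodes aliases frequencies modulo `2m+1`: for `k = j + n(2m+1)` with `|j| ≤
m`, the error has `k`-th coefficient `lam k * (ĝ(k) - θ(j/m) ĝ(j))` (`opQ_freq`,
`fourierCoeff_errFun`). So the error is `∫ K(x - t, x) g(t) dt` with `K(s, x) = ∑ a(n,j) e^{ijs}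
e^{in(2m+1)x}`, where `a(n,j)` is `lam k` times a window in `j/m`. Multiplying `K` by `|e^{is} - 1|²
= 2 - e^{is} - e^{-is}` takes second differences of `a` in `j`, and the other factor is a mere
phase. Hence `|K(s, x)| ≤ S (|e^{is} - 1|² + m⁻²)⁻¹` uniformly in `x`, with `S = ∑ (|Δ²a| + |a|/m²)`
(`enorm_errKernel_le_peak`). The last factor has integral `O(m)`, so Young's inequality reduces
everything to `S = O(J_m / m)`.

For that bound, `a` is supported on `|k| ≳ m/2`, where `lam'` is interpolated between `lam` and
`lam''` at scale `m`. Monotone type compares `lam`, `lam''` near `k` with their values near `3k`,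
and the intervals `(3k - 1, 3k + 1)` are disjoint and lie in `|x| ≥ m` (`err_term_le`,
`exists_err_sum_le`).

This works for large `m`. The finitely many remaining `m` use a crude bound on `K` and the
positivity of `J_m`. If `J_m = ∞`, only `hNorm lam p f = 0` needs an argument. -/

/-! ### Taylor estimates, second differences and the cut-off -/

theorem differentiable_deriv_of_contDiff_two {F : ℝ → ℝ} (hF : ContDiff ℝ 2 F) :
    Differentiable ℝ (deriv F) := by
  have h : ContDiff ℝ (1 + 1) F := by simpa [one_add_one_eq_two] using hF
  exact (contDiff_succ_iff_deriv.1 h).2.2.differentiable (by simp)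

/-- The mean value inequality is applied twice, first to `F'` and then to `F - F'(a) · id`; the
sharp factor `1/2` is not needed. -/
theorem abs_taylor_one_le {F : ℝ → ℝ} (hF : ContDiff ℝ 2 F) {a H B : ℝ}
    (hB : ∀ ξ, |ξ - a| ≤ H → |iteratedDeriv 2 F ξ| ≤ B) {h : ℝ} (hh : |h| ≤ H) :
    |F (a + h) - F a - h * deriv F a| ≤ B * h ^ 2 := by
  have hd := differentiable_deriv_of_contDiff_two hF
  have hF1 : Differentiable ℝ F := hF.differentiable (by simp)
  have hconv : Convex ℝ (Metric.closedBall a |h|) := convex_closedBall a _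
  have hmem : a + h ∈ Metric.closedBall a |h| := by simp
  have hmem0 : a ∈ Metric.closedBall a |h| := by simp
  have h1 : ∀ ξ ∈ Metric.closedBall a |h|, ‖deriv F ξ - deriv F a‖ ≤ B * |h| := by
    intro ξ hξ
    have hsub : ∀ x ∈ Metric.closedBall a |h|, ‖deriv (deriv F) x‖ ≤ B := by
      intro x hx
      have := hB x (le_trans (by simpa [Real.dist_eq] using hx) hh)
      rwa [iteratedDeriv_succ, iteratedDeriv_one] at this
    have := hconv.norm_image_sub_le_of_norm_deriv_le (fun x _ => hd x) hsub hmem0 hξ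
    refine this.trans ?_
    have hB0 : 0 ≤ B := (norm_nonneg _).trans (hsub a hmem0)
    exact mul_le_mul_of_nonneg_left (by simpa [Real.dist_eq] using hξ) hB0
  have h2 := hconv.norm_image_sub_le_of_norm_deriv_le
    (f := fun x => F x - x * deriv F a) (C := B * |h|)
    (fun x _ => (hF1 x).sub (by fun_prop)) (fun x hx => by
      have : deriv (fun x => F x - x * deriv F a) x = deriv F x - deriv F a := by
        have := (hF1 x).hasDerivAt.fun_sub ((hasDerivAt_id' x).mul_const (deriv F a))
        simpa using this.deriv
      rw [this]; exact h1 x hx) hmem0 hmem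
  have e : F (a + h) - F a - h * deriv F a
      = F (a + h) - (a + h) * deriv F a - (F a - a * deriv F a) := by ring
  rw [e]
  refine h2.trans (le_of_eq ?_)
  rw [add_sub_cancel_left, Real.norm_eq_abs, mul_assoc, abs_mul_abs_self, sq]

theorem abs_second_difference_le {F : ℝ → ℝ} (hF : ContDiff ℝ 2 F) {a H B : ℝ}
    (hB : ∀ ξ, |ξ - a| ≤ H → |iteratedDeriv 2 F ξ| ≤ B) {h : ℝ} (hh : |h| ≤ H) :
    |F (a + h) - 2 * F a + F (a - h)| ≤ 2 * B * h ^ 2 := by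
  have h1 := abs_taylor_one_le hF hB hh
  have h2 := abs_taylor_one_le hF hB (h := -h) (by simpa using hh)
  rw [abs_le] at *
  rw [← sub_eq_add_neg] at h2
  constructor <;> nlinarith

theorem IsCutoff.exists_bound {θ : ℝ → ℝ} (hθ : IsCutoff θ) :
    ∃ C : ℝ, 1 ≤ C ∧ ∀ x h : ℝ, |θ x| ≤ C ∧ |θ (x + h) - θ x| ≤ C * |h| ∧
      |θ (x + h) - 2 * θ x + θ (x - h)| ≤ C * h ^ 2 := by
  have hc : HasCompactSupport θ := by
    refine HasCompactSupport.intro (isCompact_Icc (a := (-1 : ℝ)) (b := 1)) fun x hx => ?_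
    exact hθ.eq_zero x fun h => hx (Set.Ioo_subset_Icc_self h)
  have hd := differentiable_deriv_of_contDiff_two hθ.contDiff
  have hF1 : Differentiable ℝ θ := hθ.contDiff.differentiable (by simp)
  have hc2 : HasCompactSupport (iteratedDeriv 2 θ) := by
    rw [iteratedDeriv_succ, iteratedDeriv_one]; exact hc.deriv.deriv
  obtain ⟨C0, h0⟩ := hF1.continuous.bounded_above_of_compact_support hc
  obtain ⟨C1, h1⟩ := hd.continuous.bounded_above_of_compact_support hc.deriv
  obtain ⟨C2, h2⟩ := (hθ.contDiff.continuous_iteratedDeriv 2 (by simp)).bounded_above_of_compact_support hc2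
  have p0 := (norm_nonneg _).trans (h0 0)
  have p1 := (norm_nonneg _).trans (h1 0)
  have p2 := (norm_nonneg _).trans (h2 0)
  -- The summand `1` gives `1 + |θ| ≤ 2C`, which later bounds the window `1 - θ`.
  refine ⟨1 + C0 + C1 + 2 * C2, by linarith, fun x h => ⟨?_, ?_, ?_⟩⟩
  · have := h0 x; rw [Real.norm_eq_abs] at this; linarith
  · have := convex_univ.norm_image_sub_le_of_norm_deriv_le (fun x _ => hF1 x)
      (fun x _ => h1 x) (Set.mem_univ x) (Set.mem_univ (x + h))
    rw [add_sub_cancel_left, Real.norm_eq_abs, Real.norm_eq_abs] at this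
    nlinarith [abs_nonneg h]
  · have := abs_second_difference_le hθ.contDiff (a := x) (H := |h|) (B := C2) (fun ξ _ => h2 ξ) le_rfl
    nlinarith [sq_nonneg h]

/-! ### Local estimates for functions of monotone type -/

/-- Two dyadic comparisons: the values of a function of monotone type at points whose moduli
differ by a factor at most `4`. -/
theorem monotone_type_compare {lam : ℝ → ℝ} {R c₀ : ℝ} (hc : 0 < c₀)
    (hmono : ∀ x y : ℝ, R ≤ |x| → R ≤ |y| → |x| ≤ 2 * |y| → |y| / 2 ≤ |x| →
      c₀ * |lam y| ≤ |lam x| ∧ c₀ * |iteratedDeriv 2 lam y| ≤ |iteratedDeriv 2 lam x|)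
    {ξ y : ℝ} (hξ : R ≤ |ξ|) (h1 : |ξ| ≤ |y|) (h2 : |y| ≤ 4 * |ξ|) :
    |lam ξ| ≤ (c₀ ^ 2)⁻¹ * |lam y| ∧
      |iteratedDeriv 2 lam ξ| ≤ (c₀ ^ 2)⁻¹ * |iteratedDeriv 2 lam y| := by
  have e : |2 * ξ| = 2 * |ξ| := by rw [abs_mul, abs_two]
  have p := abs_nonneg ξ
  obtain ⟨a1, a2⟩ := hmono (2 * ξ) ξ (by linarith) hξ (by linarith) (by linarith)
  obtain ⟨b1, b2⟩ := hmono y (2 * ξ) (by linarith) (by linarith) (by linarith) (by linarith)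
  have hc2 : 0 < c₀ ^ 2 := by positivity
  constructor <;> rw [inv_mul_eq_div, le_div_iff₀ hc2] <;> nlinarith

/-- Coefficients live on frequencies down to about `m/2`, while `J_m` only sees `|x| ≥ m`; comparing
with points near `3k` bridges this gap. Since `|k| ≥ m/2 - 1`, the window `m/20` is small enough for
`|ξ| ≤ |y| ≤ 4|ξ|`. -/
theorem bounds_near_int {lam : ℝ → ℝ} {R c₀ : ℝ} (hc : 0 < c₀)
    (hmono : ∀ x y : ℝ, R ≤ |x| → R ≤ |y| → |x| ≤ 2 * |y| → |y| / 2 ≤ |x| →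
      c₀ * |lam y| ≤ |lam x| ∧ c₀ * |iteratedDeriv 2 lam y| ≤ |iteratedDeriv 2 lam x|)
    {k m y ξ : ℝ} (hm : 40 ≤ m) (hmR : 4 * R ≤ m) (hk : m ≤ 2 * |k| + 2)
    (hy : |y - 3 * k| < 1) (hξ : |ξ - k| ≤ m / 20) :
    |lam ξ| ≤ (c₀ ^ 2)⁻¹ * |lam y| ∧
      |iteratedDeriv 2 lam ξ| ≤ (c₀ ^ 2)⁻¹ * |iteratedDeriv 2 lam y| := by
  have t1 : |k| - |ξ - k| ≤ |ξ| := by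
    have := abs_sub_abs_le_abs_sub k ξ; rw [abs_sub_comm] at this; linarith
  have t2 : |ξ| ≤ |k| + |ξ - k| := by
    have := abs_add_le k (ξ - k); rwa [add_sub_cancel] at this
  have e : |3 * k| = 3 * |k| := by rw [abs_mul]; norm_num
  have t3 : 3 * |k| - |y - 3 * k| ≤ |y| := by
    have := abs_sub_abs_le_abs_sub (3 * k) y; rw [abs_sub_comm, e] at this; linarith
  have t4 : |y| ≤ 3 * |k| + |y - 3 * k| := by
    have := abs_add_le (3 * k) (y - 3 * k); rwa [add_sub_cancel, e] at this
  apply monotone_type_compare hc hmono <;> linarith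

/-- The discrete Leibniz rule for second differences. -/
theorem second_difference_mul (u u₁ u₂ v v₁ v₂ : ℝ) :
    u₁ * v₁ - 2 * (u * v) + u₂ * v₂ = v * (u₁ - 2 * u + u₂) + (v₁ - v) * (u₁ - u)
      + (v₂ - v) * (u₂ - u) + u * (v₁ - 2 * v + v₂) := by ring

theorem second_difference_mul_bound {lam : ℝ → ℝ} (hlam : ContDiff ℝ 2 lam) {k m A B C : ℝ}
    (hm : 20 ≤ m) (hA : ∀ ξ, |ξ - k| ≤ m / 20 → |lam ξ| ≤ A)
    (hB : ∀ ξ, |ξ - k| ≤ m / 20 → |iteratedDeriv 2 lam ξ| ≤ B)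
    {v v₁ v₂ : ℝ} (hC : 0 ≤ C) (h0 : |v| ≤ C) (h1 : |v₁ - v| ≤ C / m) (h2 : |v₂ - v| ≤ C / m)
    (h3 : |v₁ - 2 * v + v₂| ≤ C / m ^ 2) :
    |lam (k + 1) * v₁ - 2 * (lam k * v) + lam (k - 1) * v₂| + |lam k * v| / m ^ 2
      ≤ 100 * C * (B + A / m ^ 2) := by
  have hm0 : 0 < m := by linarith
  have hA0 : |lam k| ≤ A := hA k (by simp; positivity)
  have hA' : 0 ≤ A := (abs_nonneg _).trans hA0
  have hB' : 0 ≤ B := (abs_nonneg _).trans (hB k (by simp; positivity))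
  have hone : |(1 : ℝ)| ≤ m / 20 := by rw [abs_one]; linarith
  have d2 : |lam (k + 1) - 2 * lam k + lam (k - 1)| ≤ 2 * B := by
    simpa using abs_second_difference_le hlam hB hone
  have dm := abs_taylor_one_le hlam hB (h := m / 20) (by rw [abs_of_pos (by positivity)])
  have hAm : |lam (k + m / 20)| ≤ A := hA _ (by rw [add_sub_cancel_left, abs_of_pos (by positivity)])
  -- Interpolation: Taylor's formula with step `m/20` bounds `lam'` by `lam` and `lam''`, balanced
  -- so that the factor `C/m` from the window restores `B + A/m²`.
  have d1 : |deriv lam k| ≤ 40 * A / m + B * m / 20 := by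
    have : |m / 20 * deriv lam k| ≤ 2 * A + B * (m / 20) ^ 2 := by
      rw [abs_le] at *; constructor <;> linarith
    rw [abs_mul, abs_of_pos (by positivity : 0 < m / 20)] at this
    have e : 2 * A + B * (m / 20) ^ 2 = m / 20 * (40 * A / m + B * m / 20) := by
      field_simp
      ring
    rw [e] at this
    exact le_of_mul_le_mul_left this (by positivity)
  have hBm : B ≤ B * m / 20 := by nlinarith
  have s1 : |lam (k + 1) - lam k| ≤ 40 * A / m + B * m / 10 := by
    have := abs_taylor_one_le hlam hB hone
    rw [abs_le] at *; constructor <;> linarith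
  have s2 : |lam (k - 1) - lam k| ≤ 40 * A / m + B * m / 10 := by
    have := abs_taylor_one_le hlam hB (h := -1) (by rwa [abs_neg])
    rw [← sub_eq_add_neg] at this
    rw [abs_le] at *; constructor <;> linarith
  have hS : 0 ≤ 40 * A / m + B * m / 10 := by positivity
  rw [second_difference_mul]
  have q0 : |v * (lam (k + 1) - 2 * lam k + lam (k - 1))| ≤ C * (2 * B) := by
    rw [abs_mul]; gcongr
  have q1 : |(v₁ - v) * (lam (k + 1) - lam k)| ≤ C / m * (40 * A / m + B * m / 10) := by
    rw [abs_mul]; gcongr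
  have q2 : |(v₂ - v) * (lam (k - 1) - lam k)| ≤ C / m * (40 * A / m + B * m / 10) := by
    rw [abs_mul]; gcongr
  have q3 : |lam k * (v₁ - 2 * v + v₂)| ≤ A * (C / m ^ 2) := by
    rw [abs_mul]; gcongr
  have q4 : |lam k * v| / m ^ 2 ≤ A * C / m ^ 2 := by
    rw [abs_mul]; gcongr
  have e : C / m * (40 * A / m + B * m / 10) = 40 * (C * A / m ^ 2) + C * B / 10 := by
    field_simp
  have e2 : 100 * C * (B + A / m ^ 2) = 100 * (C * B) + 100 * (C * A / m ^ 2) := by ring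
  have e3 : A * (C / m ^ 2) = C * A / m ^ 2 := by ring
  have e4 : A * C / m ^ 2 = C * A / m ^ 2 := by ring
  have p1 : 0 ≤ C * A / m ^ 2 := by positivity
  have p2 : 0 ≤ C * B := by positivity
  rw [e] at q1 q2; rw [e3] at q3; rw [e4] at q4; rw [e2]
  refine (add_le_add ((abs_add_le _ _).trans (add_le_add ((abs_add_le _ _).trans (add_le_add
    ((abs_add_le _ _).trans (add_le_add q0 q1)) q2)) q3)) q4).trans ?_
  linarith

/-! ### From sums over frequencies to the integral -/

/-- The part of `functionalJ m lam` that comes from the interval `(3k - 1, 3k + 1)`. -/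
def localJ (m : ℕ) (lam : ℝ → ℝ) (k : ℤ) : ℝ≥0∞ :=
  ∫⁻ x in Set.Ioo (3 * (k : ℝ) - 1) (3 * k + 1),
    ENNReal.ofReal (|lam x / (m : ℝ)| + |x * iteratedDeriv 2 lam x|)
      ∂(volume.restrict {x : ℝ | (m : ℝ) ≤ |x|})

/-- Intervals of length `2` centred at distinct multiples of `3` are disjoint. -/
theorem tsum_localJ_le (m : ℕ) (lam : ℝ → ℝ) : ∑' k, localJ m lam k ≤ functionalJ m lam := by
  unfold localJ
  rw [← lintegral_iUnion (fun _ => measurableSet_Ioo)]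
  · exact setLIntegral_le_lintegral _ _
  · intro a b hab
    refine Set.disjoint_left.2 fun x hx hx' => hab ?_
    have h1 : (3 * a - 1 : ℝ) < 3 * b + 1 := hx.1.trans hx'.2
    have h2 : (3 * b - 1 : ℝ) < 3 * a + 1 := hx'.1.trans hx.2
    norm_cast at h1 h2
    omega

/-- A pointwise bound integrates without loss because the interval has length `2 ≥ 1`. -/
theorem le_mul_localJ {m : ℕ} {lam : ℝ → ℝ} {k : ℤ} {t K : ℝ≥0∞}
    (h : ∀ y : ℝ, |y - 3 * k| < 1 → (m : ℝ) ≤ |y| ∧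
      t ≤ K * ENNReal.ofReal (|lam y / (m : ℝ)| + |y * iteratedDeriv 2 lam y|)) (hK : K ≠ ∞) :
    t ≤ K * localJ m lam k := by
  have hS : MeasurableSet {x : ℝ | (m : ℝ) ≤ |x|} := measurableSet_le measurable_const measurable_norm
  have hI : ∀ y ∈ Set.Ioo (3 * (k : ℝ) - 1) (3 * k + 1), |y - 3 * k| < 1 := by
    intro y hy; rw [abs_lt]; constructor <;> linarith [hy.1, hy.2]
  unfold localJ
  have hsub : Set.Ioo (3 * (k : ℝ) - 1) (3 * k + 1) ⊆ {x : ℝ | (m : ℝ) ≤ |x|} :=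
    fun y hy => (h y (hI y hy)).1
  rw [Measure.restrict_restrict measurableSet_Ioo, Set.inter_eq_left.2 hsub,
    ← lintegral_const_mul' _ _ hK]
  calc t ≤ t * volume (Set.Ioo (3 * (k : ℝ) - 1) (3 * k + 1)) := by
        rw [Real.volume_Ioo]
        refine le_mul_of_one_le_right' ?_
        rw [show (3 * (k : ℝ) + 1 - (3 * k - 1)) = 2 by ring]
        simp
    _ = ∫⁻ _ in Set.Ioo (3 * (k : ℝ) - 1) (3 * k + 1), t := by rw [setLIntegral_const]
    _ ≤ _ := setLIntegral_mono' measurableSet_Ioo fun y hy => (h y (hI y hy)).2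

theorem tsum_indicator_comp_le {α β : Type*} {s : Set α} {κ : α → β} (hκ : Set.InjOn κ s)
    (g : β → ℝ≥0∞) : ∑' q, s.indicator (fun q => g (κ q)) q ≤ ∑' k, g k := by
  rw [← tsum_subtype]
  exact ENNReal.tsum_comp_le_tsum_of_injective (f := fun q : s => κ q)
    (Set.injOn_iff_injective.1 hκ) g

/-! ### Counting frequencies modulo `2m + 1` -/

/-- The frequency `j + n (2m + 1)`. -/
def freq (m : ℕ) (q : ℤ × ℤ) : ℤ := q.2 + q.1 * (2 * m + 1)

theorem injOn_freq_fst_eq_zero (m : ℕ) : Set.InjOn (freq m) {q | q.1 = 0} := by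
  rintro ⟨a, b⟩ ha ⟨c, d⟩ hc h
  simp only [Set.mem_ofPred_eq] at ha hc
  subst ha hc
  simpa [freq] using h

theorem injOn_freq_abs_snd_le (m : ℕ) : Set.InjOn (freq m) {q | |q.2| ≤ m} := by
  rintro ⟨a, b⟩ ha ⟨c, d⟩ hc h
  simp only [Set.mem_ofPred_eq, freq] at ha hc h
  rw [abs_le] at ha hc
  have h1 : a = c := by
    rcases lt_trichotomy a c with h' | h' | h'
    · nlinarith
    · exact h'
    · nlinarith
  subst h1
  simpa using h

/-- The factor `2` appears because an integer is hit at most once with `n = 0` and at most once with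
`|j| ≤ m`. -/
theorem tsum_freq_le (m : ℕ) (g : ℤ → ℝ≥0∞) (t : ℤ × ℤ → ℝ≥0∞)
    (h : ∀ q, q.1 = 0 ∨ |q.2| ≤ (m : ℤ) → t q ≤ g (freq m q)) (h0 : ∀ q, ¬ (q.1 = 0 ∨ |q.2| ≤ (m : ℤ)) → t q = 0) :
    ∑' q, t q ≤ 2 * ∑' k, g k := by
  rw [two_mul]
  refine le_trans ?_ (add_le_add (tsum_indicator_comp_le (injOn_freq_fst_eq_zero m) g)
    (tsum_indicator_comp_le (injOn_freq_abs_snd_le m) g))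
  rw [← ENNReal.tsum_add]
  refine ENNReal.tsum_le_tsum fun q => ?_
  by_cases hq : q.1 = 0
  · exact (h q (.inl hq)).trans (by simp [Set.indicator, hq])
  by_cases hq' : |q.2| ≤ m
  · exact (h q (.inr hq')).trans (by simp [Set.indicator, hq, hq'])
  · rw [h0 q (by tauto)]; exact zero_le

/-! ### Error coefficients and their second differences -/

/-- The window multiplying the frequency `j + n (2m + 1)`: `1 - θ(j/m)` for `n = 0` and `-θ(j/m)`
for `n ≠ 0`. -/
def window (θ : ℝ → ℝ) (m : ℕ) (n j : ℤ) : ℝ := (if n = 0 then 1 else 0) - θ ((j : ℝ) / m)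

/-- The coefficients of the kernel of `f - Q_m(f)` as an operator on `g`. -/
def errCoeff (lam θ : ℝ → ℝ) (m : ℕ) (q : ℤ × ℤ) : ℝ := lam (freq m q) * window θ m q.1 q.2

/-- The second difference of the kernel coefficients in the second variable. -/
def errDiff (lam θ : ℝ → ℝ) (m : ℕ) (q : ℤ × ℤ) : ℝ :=
  errCoeff lam θ m (q.1, q.2 + 1) - 2 * errCoeff lam θ m q + errCoeff lam θ m (q.1, q.2 - 1)

theorem IsCutoff.eq_zero_of_le {θ : ℝ → ℝ} (hθ : IsCutoff θ) {m : ℕ} (hm : 1 ≤ m) {j : ℤ}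
    (h : (m : ℤ) ≤ |j|) : θ ((j : ℝ) / m) = 0 := by
  apply hθ.eq_zero
  have hm' : (0 : ℝ) < m := by positivity
  rw [Set.mem_Ioo, ← abs_lt, not_lt, abs_div, abs_of_pos hm', le_div_iff₀ hm', one_mul]
  exact_mod_cast h

theorem IsCutoff.eq_one_of_le {θ : ℝ → ℝ} (hθ : IsCutoff θ) {m : ℕ} (hm : 1 ≤ m) {j : ℤ}
    (h : 2 * |j| ≤ m) : θ ((j : ℝ) / m) = 1 := by
  apply hθ.eq_one
  have hm' : (0 : ℝ) < m := by positivity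
  rw [Set.mem_Icc, ← abs_le, abs_div, abs_of_pos hm', div_le_iff₀ hm']
  have : (2 * |(j : ℝ)| : ℝ) ≤ m := by exact_mod_cast h
  linarith

theorem window_eq_zero {θ : ℝ → ℝ} (hθ : IsCutoff θ) {m : ℕ} (hm : 1 ≤ m) {n j : ℤ}
    (h : (n = 0 ∧ 2 * |j| ≤ m) ∨ (n ≠ 0 ∧ (m : ℤ) ≤ |j|)) : window θ m n j = 0 := by
  rcases h with ⟨h1, h2⟩ | ⟨h1, h2⟩
  · simp [window, h1, hθ.eq_one_of_le hm h2]
  · simp [window, h1, hθ.eq_zero_of_le hm h2]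

/-- The vanishing region of the window is shrunk by one so that both neighbours `j ± 1` stay inside
it. -/
theorem err_eq_zero {lam θ : ℝ → ℝ} (hθ : IsCutoff θ) {m : ℕ} (hm : 1 ≤ m) {q : ℤ × ℤ}
    (h : (q.1 = 0 ∧ 2 * |q.2| + 2 ≤ m) ∨ (q.1 ≠ 0 ∧ (m : ℤ) + 1 ≤ |q.2|)) :
    errCoeff lam θ m q = 0 ∧ errDiff lam θ m q = 0 := by
  have h0 : window θ m q.1 q.2 = 0 := window_eq_zero hθ hm (by omega)
  have h1 : window θ m q.1 (q.2 + 1) = 0 := window_eq_zero hθ hm (by grind)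
  have h2 : window θ m q.1 (q.2 - 1) = 0 := window_eq_zero hθ hm (by grind)
  simp [errDiff, errCoeff, h0, h1, h2]

theorem err_term_le {lam θ : ℝ → ℝ} (hlam : ContDiff ℝ 2 lam) {R c₀ C : ℝ} (hc : 0 < c₀)
    (hmono : ∀ x y : ℝ, R ≤ |x| → R ≤ |y| → |x| ≤ 2 * |y| → |y| / 2 ≤ |x| →
      c₀ * |lam y| ≤ |lam x| ∧ c₀ * |iteratedDeriv 2 lam y| ≤ |iteratedDeriv 2 lam x|)
    (hC : 1 ≤ C) (hθ : ∀ x h : ℝ, |θ x| ≤ C ∧ |θ (x + h) - θ x| ≤ C * |h| ∧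
      |θ (x + h) - 2 * θ x + θ (x - h)| ≤ C * h ^ 2)
    {m : ℕ} (hm : 40 ≤ m) (hmR : 4 * R ≤ m) {q : ℤ × ℤ} (hq : (m : ℤ) ≤ 2 * |freq m q| + 2) :
    ENNReal.ofReal (|errDiff lam θ m q| + |errCoeff lam θ m q| / (m : ℝ) ^ 2) ≤
      ENNReal.ofReal (200 * C * (c₀ ^ 2)⁻¹ / m) * localJ m lam (freq m q) := by
  have hm40 : (40 : ℝ) ≤ m := by exact_mod_cast hm
  have hm0 : (0 : ℝ) < m := by linarith
  have hk : (m : ℝ) ≤ 2 * |(freq m q : ℝ)| + 2 := by exact_mod_cast hq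
  refine le_mul_localJ (fun y hy => ?_) ENNReal.ofReal_ne_top
  have e : |3 * (freq m q : ℝ)| = 3 * |(freq m q : ℝ)| := by rw [abs_mul]; norm_num
  have hym : (m : ℝ) ≤ |y| := by
    have := abs_sub_abs_le_abs_sub (3 * (freq m q : ℝ)) y
    rw [abs_sub_comm, e] at this; linarith
  refine ⟨hym, ?_⟩
  rw [← ENNReal.ofReal_mul (by positivity)]
  apply ENNReal.ofReal_le_ofReal
  have hw : ∀ i : ℤ, window θ m q.1 (q.2 + i) - window θ m q.1 q.2
      = - (θ ((q.2 : ℝ) / m + (i : ℝ) / m) - θ ((q.2 : ℝ) / m)) := by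
    intro i; simp only [window]; push_cast; rw [add_div]; ring
  have key := second_difference_mul_bound hlam (k := (freq m q : ℝ)) (m := m)
    (A := (c₀ ^ 2)⁻¹ * |lam y|) (B := (c₀ ^ 2)⁻¹ * |iteratedDeriv 2 lam y|) (C := 2 * C)
    (v := window θ m q.1 q.2) (v₁ := window θ m q.1 (q.2 + 1)) (v₂ := window θ m q.1 (q.2 - 1))
    (by linarith) (fun ξ hξ => (bounds_near_int hc hmono hm40 hmR hk hy hξ).1)
    (fun ξ hξ => (bounds_near_int hc hmono hm40 hmR hk hy hξ).2) (by linarith)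
    (by
      have := (hθ ((q.2 : ℝ) / m) 0).1
      unfold window
      rw [abs_le] at *
      split_ifs <;> constructor <;> linarith)
    (by
      have := (hθ ((q.2 : ℝ) / m) (1 / m)).2.1
      have h' := hw 1
      push_cast at h'
      rw [h', abs_neg]
      rw [abs_of_pos (by positivity : (0 : ℝ) < 1 / m)] at this
      refine this.trans ?_
      rw [mul_one_div]; gcongr; linarith)
    (by
      have := (hθ ((q.2 : ℝ) / m) (-1 / m)).2.1
      have h' := hw (-1)
      push_cast at h'
      rw [← sub_eq_add_neg] at h'
      rw [h', abs_neg]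
      rw [abs_div, abs_neg, abs_one, abs_of_pos hm0] at this
      refine this.trans ?_
      rw [mul_one_div]; gcongr; linarith)
    (by
      have := (hθ ((q.2 : ℝ) / m) (1 / m)).2.2
      have h1 := hw 1
      have h2 := hw (-1)
      push_cast at h1 h2
      rw [← sub_eq_add_neg, neg_div, ← sub_eq_add_neg] at h2
      have e : window θ m q.1 (q.2 + 1) - 2 * window θ m q.1 q.2 + window θ m q.1 (q.2 - 1)
        = - (θ ((q.2 : ℝ) / m + 1 / m) - 2 * θ ((q.2 : ℝ) / m) + θ ((q.2 : ℝ) / m - 1 / m)) := by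
        linarith
      rw [e, abs_neg]
      refine this.trans ?_
      rw [div_pow, one_pow, mul_one_div]; gcongr; linarith)
  have e1 : (freq m (q.1, q.2 + 1) : ℝ) = freq m q + 1 := by simp only [freq]; push_cast; ring
  have e2 : (freq m (q.1, q.2 - 1) : ℝ) = freq m q - 1 := by simp only [freq]; push_cast; ring
  unfold errDiff errCoeff
  rw [e1, e2]
  refine key.trans ?_
  -- The weight `|y| ≥ m` in `J_m` supplies the gain `1/m`.
  have hd : |iteratedDeriv 2 lam y| ≤ |y * iteratedDeriv 2 lam y| / m := by
    rw [abs_mul, le_div_iff₀ hm0, mul_comm]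
    exact mul_le_mul_of_nonneg_right hym (abs_nonneg _)
  have e3 : |lam y / m| = |lam y| / m := by rw [abs_div, abs_of_pos hm0]
  rw [e3]
  calc _ = 200 * C * (c₀ ^ 2)⁻¹ * (|iteratedDeriv 2 lam y| + |lam y| / (m : ℝ) ^ 2) := by ring
    _ ≤ 200 * C * (c₀ ^ 2)⁻¹ * (|y * iteratedDeriv 2 lam y| / m + |lam y| / (m : ℝ) ^ 2) := by
        gcongr
    _ = _ := by field_simp; ring

/-- The coefficient sum controlling the kernel is bounded by `J_m / m` for large `m`. -/
theorem exists_err_sum_le {lam θ : ℝ → ℝ} (hlam : IsMonotoneType lam) (hθ : IsCutoff θ) :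
    ∃ D : ℝ, 0 < D ∧ ∃ m₀ : ℕ, ∀ m : ℕ, m₀ ≤ m →
      ∑' q, ENNReal.ofReal (|errDiff lam θ m q| + |errCoeff lam θ m q| / (m : ℝ) ^ 2) ≤
        ENNReal.ofReal (D / m) * functionalJ m lam := by
  obtain ⟨hC2, R, hR, c₀, hc, hmono⟩ := hlam
  obtain ⟨C, hC, hθC⟩ := hθ.exists_bound
  -- The leading `2` is the multiplicity from `tsum_freq_le`; the threshold is what
  -- `bounds_near_int` requires.
  refine ⟨2 * (200 * C * (c₀ ^ 2)⁻¹), by positivity, 40 + ⌈4 * R⌉₊, fun m hm => ?_⟩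
  have hm40 : 40 ≤ m := by omega
  have hmR : 4 * R ≤ m := (Nat.le_ceil _).trans (by exact_mod_cast (by omega : ⌈4 * R⌉₊ ≤ m))
  have hzero : ∀ q : ℤ × ℤ, ((q.1 = 0 ∧ 2 * |q.2| + 2 ≤ m) ∨ (q.1 ≠ 0 ∧ (m : ℤ) + 1 ≤ |q.2|)) →
      ENNReal.ofReal (|errDiff lam θ m q| + |errCoeff lam θ m q| / (m : ℝ) ^ 2) = 0 := by
    intro q hq
    obtain ⟨h1, h2⟩ := err_eq_zero (lam := lam) hθ (by omega) hq
    simp [h1, h2]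
  refine (tsum_freq_le m (fun k => ENNReal.ofReal (200 * C * (c₀ ^ 2)⁻¹ / m) * localJ m lam k) _
    (fun q hq => ?_) fun q hq => hzero q ?_).trans ?_
  · by_cases hz : (q.1 = 0 ∧ 2 * |q.2| + 2 ≤ m) ∨ (q.1 ≠ 0 ∧ (m : ℤ) + 1 ≤ |q.2|)
    · rw [hzero q hz]; exact zero_le
    refine err_term_le hC2 hc hmono hC hθC hm40 hmR ?_
    by_cases hn : q.1 = 0
    · have : freq m q = q.2 := by simp [freq, hn]
      rw [this]; omega
    · have hj : |q.2| ≤ m := by omega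
      have h1 : (2 * m + 1 : ℤ) ≤ |q.1 * (2 * m + 1)| := by
        rw [abs_mul, abs_of_nonneg (by positivity : (0 : ℤ) ≤ 2 * m + 1)]
        have := Int.one_le_abs hn
        nlinarith
      have h2 : |q.1 * (2 * m + 1)| ≤ |freq m q| + |q.2| := by
        have := abs_sub (freq m q) q.2
        simpa [freq] using this
      omega
  · push Not at hq
    exact .inr ⟨hq.1, hq.2⟩
  · rw [ENNReal.tsum_mul_left, ← mul_assoc, mul_div_assoc 2, ENNReal.ofReal_mul two_pos.le]
    rw [ENNReal.ofReal_ofNat]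
    gcongr
    exact tsum_localJ_le m lam

/-! ### Summability when `J_m` is finite, and positivity of `J_m` -/

/-- Outside a finite set of `k`, monotone type dominates `lam k` by `lam` on `(3k - 1, 3k + 1)`,
hence by a multiple of the summable `localJ`. -/
theorem summable_of_functionalJ_ne_top {lam : ℝ → ℝ} (hlam : IsMonotoneType lam) {m : ℕ}
    (hm : 1 ≤ m) (hJ : functionalJ m lam ≠ ∞) : Summable fun k : ℤ => |lam k| := by
  obtain ⟨hC2, R, hR, c₀, hc, hmono⟩ := hlam
  have hm0 : (0 : ℝ) < m := by positivity
  have hsum : ∑' k, ENNReal.ofReal ((c₀ ^ 2)⁻¹ * m) * localJ m lam k ≠ ∞ := by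
    rw [ENNReal.tsum_mul_left]
    exact ENNReal.mul_ne_top ENNReal.ofReal_ne_top (ne_top_of_le_ne_top hJ (tsum_localJ_le m lam))
  refine Summable.of_norm_bounded_eventually (ENNReal.summable_toReal hsum) ?_
  have hfin : (Set.Icc (-(⌈R⌉₊ + m + 1 : ℤ)) (⌈R⌉₊ + m + 1)).Finite := Set.finite_Icc _ _
  filter_upwards [hfin.compl_mem_cofinite] with k hk
  have hk' : (⌈R⌉₊ + m + 1 : ℝ) ≤ |(k : ℝ)| := by
    have : (⌈R⌉₊ + m + 1 : ℤ) ≤ |k| := by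
      rw [Set.mem_compl_iff, Set.mem_Icc, ← abs_le] at hk; omega
    exact_mod_cast this
  have hRk := Nat.le_ceil R
  rw [Real.norm_eq_abs, abs_abs, ← ENNReal.ofReal_le_iff_le_toReal (ENNReal.ne_top_of_tsum_ne_top hsum k)]
  refine le_mul_localJ (fun y hy => ?_) ENNReal.ofReal_ne_top
  have e : |3 * (k : ℝ)| = 3 * |(k : ℝ)| := by rw [abs_mul]; norm_num
  have t3 : 3 * |(k : ℝ)| - |y - 3 * k| ≤ |y| := by
    have := abs_sub_abs_le_abs_sub (3 * (k : ℝ)) y; rw [abs_sub_comm, e] at this; linarith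
  have t4 : |y| ≤ 3 * |(k : ℝ)| + |y - 3 * k| := by
    have := abs_add_le (3 * (k : ℝ)) (y - 3 * k); rwa [add_sub_cancel, e] at this
  refine ⟨by linarith, ?_⟩
  have hm1 : (1 : ℝ) ≤ m := by exact_mod_cast hm
  have := (monotone_type_compare hc hmono (ξ := k) (y := y) (by linarith) (by linarith)
    (by linarith)).1
  rw [← ENNReal.ofReal_mul (by positivity)]
  apply ENNReal.ofReal_le_ofReal
  have e3 : |lam y / m| = |lam y| / m := by rw [abs_div, abs_of_pos hm0]
  have p := abs_nonneg (y * iteratedDeriv 2 lam y)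
  calc |lam k| ≤ (c₀ ^ 2)⁻¹ * |lam y| := this
    _ = (c₀ ^ 2)⁻¹ * m * |lam y / m| := by rw [e3]; field_simp
    _ ≤ _ := by gcongr; linarith

theorem summable_errCoeff {lam θ : ℝ → ℝ} (hs : Summable fun k : ℤ => |lam k|) (hθ : IsCutoff θ)
    {m : ℕ} (hm : 1 ≤ m) : Summable fun q => |errCoeff lam θ m q| := by
  obtain ⟨C, hC, hθC⟩ := hθ.exists_bound
  have hsum : ∑' q, ENNReal.ofReal |errCoeff lam θ m q| ≠ ∞ := by
    refine ne_top_of_le_ne_top (ENNReal.mul_ne_top ENNReal.ofNat_ne_top (hs.mul_left (2 * C)).tsum_ofReal_ne_top)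
      (tsum_freq_le m (fun k => ENNReal.ofReal (2 * C * |lam k|)) _ (fun q _ => ?_) fun q hq => ?_)
    · apply ENNReal.ofReal_le_ofReal
      rw [errCoeff, abs_mul, mul_comm]
      have : |window θ m q.1 q.2| ≤ 2 * C := by
        have := (hθC ((q.2 : ℝ) / m) 0).1
        unfold window
        rw [abs_le] at *
        split_ifs <;> constructor <;> linarith
      gcongr
    · push Not at hq
      rw [errCoeff, window_eq_zero hθ hm (.inr ⟨hq.1, hq.2.le⟩)]
      simp
  have := ENNReal.summable_toReal hsum
  simpa [ENNReal.toReal_ofReal] using this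

theorem functionalJ_pos {lam : ℝ → ℝ} (hlam : ContDiff ℝ 2 lam) (h0 : ∀ x, lam x ≠ 0) {m : ℕ}
    (hm : 1 ≤ m) : functionalJ m lam ≠ 0 := by
  have hS : MeasurableSet {x : ℝ | (m : ℝ) ≤ |x|} := measurableSet_le measurable_const measurable_norm
  have hd := hlam.continuous_iteratedDeriv 2 le_rfl
  have hm0 : (m : ℝ) ≠ 0 := by positivity
  have hmeas : Measurable fun x : ℝ =>
      ENNReal.ofReal (|lam x / (m : ℝ)| + |x * iteratedDeriv 2 lam x|) := by
    have := hlam.continuous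
    exact Measurable.ennreal_ofReal (by fun_prop)
  unfold functionalJ
  rw [← pos_iff_ne_zero, setLIntegral_pos_iff hmeas]
  have hsub : Set.Ioo (m : ℝ) (m + 1) ⊆ (Function.support fun x : ℝ =>
      ENNReal.ofReal (|lam x / (m : ℝ)| + |x * iteratedDeriv 2 lam x|)) ∩ {x : ℝ | (m : ℝ) ≤ |x|} := by
    intro x hx
    refine ⟨?_, hx.1.le.trans (le_abs_self x)⟩
    rw [Function.mem_support, ← pos_iff_ne_zero, ENNReal.ofReal_pos]
    have := abs_pos.2 (div_ne_zero (h0 x) hm0)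
    positivity
  refine lt_of_lt_of_le ?_ (measure_mono hsub)
  rw [Real.volume_Ioo]; simp

/-! ### Characters and the integrable majorant -/

theorem fourier_sub_apply (n : ℤ) (x t : Torus) :
    fourier n (x - t) = (fourier n x : ℂ) * fourier (-n) t := by
  simp only [fourier_apply, sub_eq_add_neg, AddCircle.toCircle_add, neg_smul, smul_add,
    smul_neg, Circle.coe_mul]

theorem norm_fourier_apply (n : ℤ) (x : Torus) : ‖(fourier n x : ℂ)‖ = 1 := by
  rw [fourier_apply]; exact Circle.norm_coe _

theorem normSq_fourier_one_sub_one (s : Torus) :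
    ((‖(fourier 1 s : ℂ) - 1‖ ^ 2 : ℝ) : ℂ) = 2 - fourier 1 s - fourier (-1) s := by
  have h : (fourier 1 s : ℂ) * fourier (-1) s = 1 := by
    rw [← fourier_add]; simp
  rw [← Complex.normSq_eq_norm_sq, ← Complex.mul_conj, map_sub, map_one, ← fourier_neg]
  linear_combination h

/-- An integrable majorant, up to a constant, for the kernels with controlled second differences. -/
def peak (m : ℕ) (s : Torus) : ℝ≥0∞ :=
  ENNReal.ofReal (‖(fourier 1 s : ℂ) - 1‖ ^ 2 + 1 / (m : ℝ) ^ 2)⁻¹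

theorem measurable_peak (m : ℕ) : Measurable (peak m) := by
  have : Continuous fun s : Torus => (fourier 1 s : ℂ) := (fourier 1).continuous
  exact Measurable.ennreal_ofReal (Measurable.inv (by fun_prop))

/-- Jordan's inequality gives `|e^{ix} - 1| = 2|sin(x/2)| ≥ 2|x|/π`, so a rescaled Cauchy density
dominates. -/
theorem peak_coe_le {m : ℕ} (hm : 1 ≤ m) {x : ℝ} (hx : |x| ≤ Real.pi) :
    peak m (x : Torus) ≤ ENNReal.ofReal ((m : ℝ) ^ 2 * (1 + (2 * m / Real.pi * x) ^ 2)⁻¹) := by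
  have hm0 : (0 : ℝ) < m := by positivity
  apply ENNReal.ofReal_le_ofReal
  have e : (fourier 1 (x : Torus) : ℂ) = Complex.exp (Complex.I * x) := by
    rw [fourier_coe_apply]
    congr 1
    have : (Real.pi : ℂ) ≠ 0 := by exact_mod_cast Real.pi_ne_zero
    push_cast
    field_simp
  have h1 : 2 / Real.pi * |x| ≤ ‖(fourier 1 (x : Torus) : ℂ) - 1‖ := by
    rw [e, Complex.norm_exp_I_mul_ofReal_sub_one, norm_mul, Real.norm_eq_abs, Real.norm_eq_abs, abs_two]
    have := Real.mul_abs_le_abs_sin (x := x / 2) (by rw [abs_div, abs_two]; linarith)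
    rw [abs_div, abs_two] at this
    linarith
  have h2 : (2 / Real.pi * x) ^ 2 ≤ ‖(fourier 1 (x : Torus) : ℂ) - 1‖ ^ 2 := by
    rw [← sq_abs, abs_mul, abs_of_pos (by positivity : 0 < 2 / Real.pi)]
    gcongr
  have e2 : (m : ℝ) ^ 2 * (1 + (2 * m / Real.pi * x) ^ 2)⁻¹
      = ((2 / Real.pi * x) ^ 2 + 1 / (m : ℝ) ^ 2)⁻¹ := by
    rw [← inv_inv ((m : ℝ) ^ 2), ← mul_inv]
    congr 1
    field_simp
    ring
  rw [e2]
  gcongr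

theorem lintegral_peak_le {m : ℕ} (hm : 1 ≤ m) :
    ∫⁻ s, peak m s ∂torusMeasure ≤ ENNReal.ofReal (Real.pi / 4 * m) := by
  have hm0 : (0 : ℝ) < m := by positivity
  have hpi := Real.pi_pos
  have ha : 2 * m / Real.pi ≠ 0 := by positivity
  have hint : Integrable fun x : ℝ => (m : ℝ) ^ 2 * (1 + (2 * m / Real.pi * x) ^ 2)⁻¹ :=
    (integrable_inv_one_add_sq.comp_mul_left' ha).const_mul _
  have hvol : ∫⁻ s : Torus, peak m s ≤ ENNReal.ofReal (m * Real.pi ^ 2 / 2) := by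
    rw [← AddCircle.lintegral_preimage (2 * Real.pi) (-Real.pi)]
    calc _ ≤ ∫⁻ x in Set.Ioc (-Real.pi) (-Real.pi + 2 * Real.pi),
          ENNReal.ofReal ((m : ℝ) ^ 2 * (1 + (2 * m / Real.pi * x) ^ 2)⁻¹) :=
        setLIntegral_mono' measurableSet_Ioc fun x hx =>
          peak_coe_le hm (abs_le.2 ⟨hx.1.le, by linarith [hx.2]⟩)
      _ ≤ ∫⁻ x, ENNReal.ofReal ((m : ℝ) ^ 2 * (1 + (2 * m / Real.pi * x) ^ 2)⁻¹) :=
        setLIntegral_le_lintegral _ _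
      _ = _ := by
        rw [← ofReal_integral_eq_lintegral_ofReal hint (.of_forall fun x => by positivity),
          integral_const_mul,
          Measure.integral_comp_mul_left (fun x : ℝ => (1 + x ^ 2)⁻¹) (2 * m / Real.pi),
          integral_univ_inv_one_add_sq, abs_of_pos (by positivity)]
        congr 1
        rw [smul_eq_mul]
        field_simp
  rw [AddCircle.volume_eq_smul_haarAddCircle, lintegral_smul_measure, smul_eq_mul] at hvol
  have e : m * Real.pi ^ 2 / 2 = 2 * Real.pi * (Real.pi / 4 * m) := by ring
  rw [e, ENNReal.ofReal_mul (p := 2 * Real.pi) (by positivity)] at hvol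
  exact (ENNReal.mul_le_mul_iff_right (ENNReal.ofReal_pos.2 Real.two_pi_pos).ne'
    ENNReal.ofReal_ne_top).1 hvol

/-! ### Young's inequality -/

/-- Young's inequality for an operator dominated by convolution with `P`. -/
theorem eLpNorm_le_of_enorm_le_convolution {p : ℝ≥0∞} (hp : 1 ≤ p) {P : Torus → ℝ≥0∞}
    (hP : Measurable P) {u g : Torus → ℂ} (hg : AEStronglyMeasurable g torusMeasure)
    (h : ∀ x, ‖u x‖ₑ ≤ ∫⁻ t, P (x - t) * ‖g t‖ₑ ∂torusMeasure) :
    eLpNorm u p torusMeasure ≤ (∫⁻ s, P s ∂torusMeasure) * eLpNorm g p torusMeasure := by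
  set A := ∫⁻ s, P s ∂torusMeasure with hA
  have hAx : ∀ x, ∫⁻ t, P (x - t) ∂torusMeasure = A := fun x =>
    lintegral_sub_left_eq_self P x
  have hPl : ∀ x, Measurable fun t => P (x - t) := fun x =>
    hP.comp (measurable_const.sub measurable_id)
  have hPr : ∀ t, Measurable fun x => P (x - t) := fun t =>
    hP.comp (measurable_id.sub measurable_const)
  rcases eq_or_ne p ∞ with rfl | hpt
  · rw [eLpNorm_exponent_top, eLpNorm_exponent_top]
    refine essSup_le_of_ae_le _ (.of_forall fun x => (h x).trans ?_)
    calc _ ≤ ∫⁻ t, P (x - t) * eLpNormEssSup g torusMeasure ∂torusMeasure := by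
          refine lintegral_mono_ae ?_
          filter_upwards [enorm_ae_le_eLpNormEssSup g torusMeasure] with t ht
          gcongr
      _ = A * eLpNormEssSup g torusMeasure := by
          rw [lintegral_mul_const _ (hPl x), hAx]
  · have hp0 : p ≠ 0 := (zero_lt_one.trans_le hp).ne'
    set q := p.toReal with hq
    have hq1 : 1 ≤ q := by
      simpa using (ENNReal.toReal_le_toReal ENNReal.one_ne_top hpt).2 hp
    have hq0 : 0 < q := by linarith
    have hpow : ∀ x, ‖u x‖ₑ ^ q ≤ A ^ (q - 1) * ∫⁻ t, P (x - t) * ‖g t‖ₑ ^ q ∂torusMeasure := by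
      intro x
      have hPx := hPl x
      -- Hölder's inequality for `|g|` under the measure `P(x - t) dt` of total mass `A`; Tonelli
      -- then integrates in `x`.
      set ν := (torusMeasure).withDensity fun t => P (x - t) with hν
      have hgν : AEStronglyMeasurable g ν := hg.mono_ac (withDensity_absolutelyContinuous _ _)
      have h1 : ∀ r : ℝ, ∫⁻ t, ‖g t‖ₑ ^ r ∂ν = ∫⁻ t, P (x - t) * ‖g t‖ₑ ^ r ∂torusMeasure := by
        intro r
        rw [hν, lintegral_withDensity_eq_lintegral_mul₀ hPx.aemeasurable
          (hg.enorm.pow_const r)]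
        rfl
      have h2 := eLpNorm'_le_eLpNorm'_mul_rpow_measure_univ zero_lt_one hq1 hgν
      have huniv : ν Set.univ = A := by
        rw [hν, withDensity_apply _ MeasurableSet.univ, Measure.restrict_univ, hAx]
      rw [huniv, eLpNorm'_eq_lintegral_enorm, eLpNorm'_eq_lintegral_enorm, h1, h1] at h2
      simp only [ENNReal.rpow_one, div_one] at h2
      calc ‖u x‖ₑ ^ q ≤ ((∫⁻ t, P (x - t) * ‖g t‖ₑ ^ q ∂torusMeasure) ^ (1 / q)
            * A ^ (1 - 1 / q)) ^ q := ENNReal.rpow_le_rpow ((h x).trans h2) hq0.le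
        _ = _ := by
          rw [ENNReal.mul_rpow_of_nonneg _ _ hq0.le, ← ENNReal.rpow_mul, ← ENNReal.rpow_mul,
            one_div_mul_cancel hq0.ne', ENNReal.rpow_one, mul_comm]
          congr 2
          field_simp
    rw [eLpNorm_eq_lintegral_rpow_enorm_toReal hp0 hpt, eLpNorm_eq_lintegral_rpow_enorm_toReal hp0 hpt,
      ← hq]
    have hmeas : AEMeasurable (Function.uncurry fun x t => P (x - t) * ‖g t‖ₑ ^ q)
        (torusMeasure.prod torusMeasure) :=
      (hP.comp (measurable_fst.sub measurable_snd)).aemeasurable.mul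
        ((hg.comp_snd (μ := torusMeasure)).enorm.pow_const q)
    have hAt : ∀ t, ∫⁻ x, P (x - t) ∂torusMeasure = A := fun t => lintegral_sub_right_eq_self P t
    calc (∫⁻ x, ‖u x‖ₑ ^ q ∂torusMeasure) ^ (1 / q)
        ≤ (A ^ q * ∫⁻ t, ‖g t‖ₑ ^ q ∂torusMeasure) ^ (1 / q) := by
          gcongr
          calc _ ≤ ∫⁻ x, A ^ (q - 1) * ∫⁻ t, P (x - t) * ‖g t‖ₑ ^ q ∂torusMeasure ∂torusMeasure :=
                lintegral_mono hpow
            _ = A ^ (q - 1) * ∫⁻ t, ∫⁻ x, P (x - t) * ‖g t‖ₑ ^ q ∂torusMeasure ∂torusMeasure := by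
                rw [lintegral_const_mul'' _ hmeas.lintegral_prod_right, lintegral_lintegral_swap hmeas]
            _ = A ^ (q - 1) * (A * ∫⁻ t, ‖g t‖ₑ ^ q ∂torusMeasure) := by
                rw [← lintegral_const_mul'' _ (hg.enorm.pow_const q)]
                congr 2 with t
                rw [lintegral_mul_const _ (hPr t), hAt]
            _ = _ := by
                rw [← mul_assoc]
                congr 1
                nth_rewrite 2 [← ENNReal.rpow_one A]
                rw [← ENNReal.rpow_add_of_nonneg _ _ (by linarith) zero_le_one, sub_add_cancel]
      _ = _ := by
          rw [ENNReal.mul_rpow_of_nonneg _ _ (by positivity), ← ENNReal.rpow_mul,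
            mul_one_div_cancel hq0.ne', ENNReal.rpow_one]

/-! ### The error kernel and the error function -/

/-- The kernel, as a function of `s = x - t` and `x`, of `f - Q_m(f)` as an operator on `g`. -/
def errKernel (lam θ : ℝ → ℝ) (m : ℕ) (s x : Torus) : ℂ :=
  ∑' q : ℤ × ℤ, (errCoeff lam θ m q : ℂ) * (fourier q.2 s * fourier (q.1 * (2 * m + 1)) x)

/-- The function representing `f - Q_m(f)`. -/
def errFun (lam θ : ℝ → ℝ) (m : ℕ) (g : Torus → ℂ) (x : Torus) : ℂ :=
  ∑' q : ℤ × ℤ, (errCoeff lam θ m q : ℂ) * fourierCoeff g q.2 * fourier (freq m q) x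

theorem norm_fourierCoeff_le (g : Torus → ℂ) (k : ℤ) :
    ‖fourierCoeff g k‖ ≤ ∫ t, ‖g t‖ ∂torusMeasure := by
  refine (norm_integral_le_integral_norm _).trans (le_of_eq ?_)
  congr 1 with t
  rw [norm_smul, norm_fourier_apply, one_mul]

theorem summable_errKernel {lam θ : ℝ → ℝ} {m : ℕ} (hs : Summable fun q => |errCoeff lam θ m q|)
    (s x : Torus) : Summable fun q : ℤ × ℤ =>
      (errCoeff lam θ m q : ℂ) * (fourier q.2 s * fourier (q.1 * (2 * m + 1)) x) := by
  refine Summable.of_norm (hs.congr fun q => ?_)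
  rw [norm_mul, norm_mul, norm_fourier_apply, norm_fourier_apply, Complex.norm_real,
    Real.norm_eq_abs, mul_one, mul_one]

theorem enorm_errKernel_le (lam θ : ℝ → ℝ) (m : ℕ) (s x : Torus) :
    ‖errKernel lam θ m s x‖ₑ ≤ ∑' q, ENNReal.ofReal |errCoeff lam θ m q| := by
  refine enorm_tsum_le_tsum_enorm.trans (ENNReal.tsum_le_tsum fun q => le_of_eq ?_)
  rw [← ofReal_norm, norm_mul, norm_mul, norm_fourier_apply, norm_fourier_apply, Complex.norm_real,
    Real.norm_eq_abs, mul_one, mul_one]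

/-- Summation by parts twice in `j` only: `e^{in(2m+1)x}` is untouched and has modulus one, which
makes the bound uniform in `x`. The term `m⁻²` takes over near `s = 0`. -/
theorem enorm_errKernel_le_peak {lam θ : ℝ → ℝ} {m : ℕ} (hm : 1 ≤ m)
    (hs : Summable fun q => |errCoeff lam θ m q|) (s x : Torus) :
    ‖errKernel lam θ m s x‖ₑ ≤
      (∑' q, ENNReal.ofReal (|errDiff lam θ m q| + |errCoeff lam θ m q| / (m : ℝ) ^ 2)) *
        peak m s := by
  have hm0 : (0 : ℝ) < m := by positivity
  set W : ℤ × ℤ → ℂ := fun q => fourier q.2 s * fourier (q.1 * (2 * m + 1)) x with hW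
  set K := errKernel lam θ m s x with hK
  have h0 : HasSum (fun q => (errCoeff lam θ m q : ℂ) * W q) K := (summable_errKernel hs s x).hasSum
  -- Multiplication by `e^{iσs}`, with `σ` the integer shift, translates the coefficients in `j` by
  -- `σ`.
  have hsh (i : ℤ) : HasSum (fun q : ℤ × ℤ => (errCoeff lam θ m (q.1, q.2 - i) : ℂ) * W q)
      (K * fourier i s) := by
    rw [← ((Equiv.refl ℤ).prodCongr (Equiv.addRight i)).hasSum_iff]
    refine (h0.mul_right (fourier i s : ℂ)).congr_fun ?_
    intro q
    simp only [Function.comp, Equiv.prodCongr_apply, Prod.map, Equiv.refl_apply, Equiv.coe_addRight,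
      add_sub_cancel_right, hW, fourier_add]
    ring
  have h1 := hsh 1
  have h2 := hsh (-1)
  have hsum : HasSum (fun q => ((errCoeff lam θ m q / (m : ℝ) ^ 2 - errDiff lam θ m q : ℝ) : ℂ) * W q)
      (((‖(fourier 1 s : ℂ) - 1‖ ^ 2 + 1 / (m : ℝ) ^ 2 : ℝ) : ℂ) * K) := by
    rw [Complex.ofReal_add, normSq_fourier_one_sub_one]
    have := ((h0.mul_left ((2 + 1 / (m : ℝ) ^ 2 : ℝ) : ℂ)).sub h1).sub h2
    have e : (2 - fourier 1 s - fourier (-1) s + ((1 / (m : ℝ) ^ 2 : ℝ) : ℂ)) * K =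
        ((2 + 1 / (m : ℝ) ^ 2 : ℝ) : ℂ) * K - K * fourier 1 s - K * fourier (-1) s := by
      push_cast
      ring
    rw [e]
    refine this.congr_fun fun q => ?_
    simp only [errDiff, sub_neg_eq_add]
    push_cast
    ring
  have hpos : 0 < ‖(fourier 1 s : ℂ) - 1‖ ^ 2 + 1 / (m : ℝ) ^ 2 := by positivity
  have hle : ENNReal.ofReal (‖(fourier 1 s : ℂ) - 1‖ ^ 2 + 1 / (m : ℝ) ^ 2) * ‖K‖ₑ ≤
      ∑' q, ENNReal.ofReal (|errDiff lam θ m q| + |errCoeff lam θ m q| / (m : ℝ) ^ 2) := by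
    have e : ENNReal.ofReal (‖(fourier 1 s : ℂ) - 1‖ ^ 2 + 1 / (m : ℝ) ^ 2) * ‖K‖ₑ =
        ‖((‖(fourier 1 s : ℂ) - 1‖ ^ 2 + 1 / (m : ℝ) ^ 2 : ℝ) : ℂ) * K‖ₑ := by
      rw [enorm_mul, ← ofReal_norm ((_ : ℝ) : ℂ), Complex.norm_real, Real.norm_of_nonneg hpos.le]
    rw [e, ← hsum.tsum_eq]
    refine enorm_tsum_le_tsum_enorm.trans (ENNReal.tsum_le_tsum fun q => ?_)
    rw [← ofReal_norm, norm_mul, Complex.norm_real, hW, norm_mul, norm_fourier_apply,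
      norm_fourier_apply, mul_one, mul_one, Real.norm_eq_abs]
    apply ENNReal.ofReal_le_ofReal
    refine (abs_sub _ _).trans (le_of_eq ?_)
    rw [abs_div, abs_of_pos (by positivity : (0 : ℝ) < m ^ 2), add_comm]
  rw [peak, ENNReal.ofReal_inv_of_pos hpos, ← div_eq_mul_inv,
    ENNReal.le_div_iff_mul_le (.inl (by simpa using hpos)) (.inl ENNReal.ofReal_ne_top), mul_comm]
  exact hle

/-- The identity `e^{i(j + n(2m+1))x} e^{-ijt} = e^{ij(x-t)} e^{in(2m+1)x}`, with absolute
summability to exchange sum and integral. -/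
theorem errFun_eq_integral {lam θ : ℝ → ℝ} {m : ℕ} (hs : Summable fun q => |errCoeff lam θ m q|)
    {g : Torus → ℂ} (hg : Integrable g torusMeasure) (x : Torus) :
    errFun lam θ m g x = ∫ t, errKernel lam θ m (x - t) x * g t ∂torusMeasure := by
  set F : ℤ × ℤ → Torus → ℂ := fun q t =>
    (errCoeff lam θ m q : ℂ) * (fourier q.2 (x - t) * fourier (q.1 * (2 * m + 1)) x) * g t with hF
  have hF' : ∀ q, F q = fun t => ((errCoeff lam θ m q : ℂ) * fourier (freq m q) x) *
      (fourier (-q.2) t • g t) := by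
    intro q
    funext t
    simp only [hF, fourier_sub_apply, freq, fourier_add, smul_eq_mul]
    ring
  have hint : ∀ q, Integrable (F q) torusMeasure := fun q => by
    rw [hF']; exact (hg.fourier_smul _).const_mul _
  have hnorm : ∀ q, ∫ t, ‖F q t‖ ∂torusMeasure = |errCoeff lam θ m q| * ∫ t, ‖g t‖ ∂torusMeasure := by
    intro q
    rw [← integral_const_mul]
    congr 1 with t
    simp only [hF, norm_mul, norm_fourier_apply, Complex.norm_real, Real.norm_eq_abs, mul_one]
  have hsum := hasSum_integral_of_summable_integral_norm hint
    (by simp_rw [hnorm]; exact hs.mul_right _)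
  have e1 : ∀ t, ∑' q, F q t = errKernel lam θ m (x - t) x * g t := fun t => tsum_mul_right
  have e2 : ∀ q, ∫ t, F q t ∂torusMeasure =
      (errCoeff lam θ m q : ℂ) * fourierCoeff g q.2 * fourier (freq m q) x := by
    intro q
    rw [hF', integral_const_mul, fourierCoeff]
    ring
  simp_rw [e1, e2] at hsum
  exact hsum.tsum_eq

theorem norm_errFun_term_le {lam θ : ℝ → ℝ} {m : ℕ} (g : Torus → ℂ) (q : ℤ × ℤ) (x : Torus) :
    ‖(errCoeff lam θ m q : ℂ) * fourierCoeff g q.2 * fourier (freq m q) x‖ ≤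
      |errCoeff lam θ m q| * ∫ t, ‖g t‖ ∂torusMeasure := by
  rw [norm_mul, norm_fourier_apply, mul_one, norm_mul, Complex.norm_real, Real.norm_eq_abs]
  gcongr
  exact norm_fourierCoeff_le g q.2

theorem continuous_errFun {lam θ : ℝ → ℝ} {m : ℕ} (hs : Summable fun q => |errCoeff lam θ m q|)
    (g : Torus → ℂ) : Continuous (errFun lam θ m g) :=
  continuous_tsum (fun q => by fun_prop) (hs.mul_right _) fun q x => norm_errFun_term_le g q x

theorem hasSum_fourierCoeff_errFun {lam θ : ℝ → ℝ} {m : ℕ}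
    (hs : Summable fun q => |errCoeff lam θ m q|) (g : Torus → ℂ) (k : ℤ) :
    HasSum (fun q => if freq m q = k then (errCoeff lam θ m q : ℂ) * fourierCoeff g q.2 else 0)
      (fourierCoeff (errFun lam θ m g) k) := by
  set F : ℤ × ℤ → Torus → ℂ := fun q x => fourier (-k) x •
    ((errCoeff lam θ m q : ℂ) * fourierCoeff g q.2 * fourier (freq m q) x) with hF
  have hcont : ∀ q, Continuous (F q) := fun q => by fun_prop
  have hint : ∀ q, Integrable (F q) torusMeasure := fun q =>
    (hcont q).integrable_of_hasCompactSupport (HasCompactSupport.of_compactSpace _)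
  have hbound : ∀ q, ∫ x, ‖F q x‖ ∂torusMeasure ≤
      |errCoeff lam θ m q| * ∫ t, ‖g t‖ ∂torusMeasure := by
    intro q
    have := integral_mono (hint q).norm
      (integrable_const (μ := torusMeasure) (|errCoeff lam θ m q| * ∫ t, ‖g t‖ ∂torusMeasure))
      (fun x => by
        simp only [hF, norm_smul, norm_fourier_apply, one_mul]
        exact norm_errFun_term_le g q x)
    simpa using this
  have hsum := hasSum_integral_of_summable_integral_norm hint
    (Summable.of_nonneg_of_le (fun q => integral_nonneg fun x => norm_nonneg _) hbound
      (hs.mul_right _))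
  have e1 : ∀ x, ∑' q, F q x = fourier (-k) x • errFun lam θ m g x := fun x => tsum_mul_left
  have e2 : ∀ q, ∫ x, F q x ∂torusMeasure =
      if freq m q = k then (errCoeff lam θ m q : ℂ) * fourierCoeff g q.2 else 0 := by
    intro q
    have := congrFun (fourierCoeff_fourier (T := 2 * Real.pi) (freq m q)) k
    rw [fourierCoeff] at this
    have e3 : ∀ x, F q x = ((errCoeff lam θ m q : ℂ) * fourierCoeff g q.2) *
        (fourier (-k) x • fourier (freq m q) x) := fun x => by
      simp only [hF, smul_eq_mul]; ring
    simp_rw [e3]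
    rw [integral_const_mul, this, Pi.single_apply]
    simp [eq_comm]
  simp_rw [e1, e2] at hsum
  exact hsum

/-! ### Fourier coefficients of the error and aliasing -/

theorem exists_freq_eq (m : ℕ) (k : ℤ) : ∃ q : ℤ × ℤ, |q.2| ≤ m ∧ freq m q = k := by
  refine ⟨((k + m) / (2 * m + 1), (k + m) % (2 * m + 1) - m), ?_, ?_⟩
  · have h1 := Int.emod_nonneg (k + m) (by positivity : (2 * (m : ℤ) + 1) ≠ 0)
    have h2 := Int.emod_lt_of_pos (k + m) (by positivity : 0 < (2 * (m : ℤ) + 1))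
    rw [abs_le]
    constructor <;> simp only <;> omega
  · have := Int.emod_add_ediv_mul (k + m) (2 * m + 1)
    simp only [freq]
    linarith

/-- Among the pairs with frequency `k`, the term `ĝ(k)` comes from `(0, k)` and the term in `θ` from
the representative with `|j| ≤ m`. Summing them as two separate point masses covers the case where
the two pairs coincide. -/
theorem fourierCoeff_errFun {lam θ : ℝ → ℝ} {m : ℕ} (hθ : IsCutoff θ) (hm : 1 ≤ m)
    (hs : Summable fun q => |errCoeff lam θ m q|) (g : Torus → ℂ) {q : ℤ × ℤ} (hq : |q.2| ≤ m) :
    fourierCoeff (errFun lam θ m g) (freq m q) = lam (freq m q) *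
      (fourierCoeff g (freq m q) - θ (q.2 / m) * fourierCoeff g q.2) := by
  refine (hasSum_fourierCoeff_errFun hs g (freq m q)).unique ?_
  have h1 : HasSum (fun r : ℤ × ℤ => if r = (0, freq m q) then fourierCoeff g (freq m q) else 0)
      (fourierCoeff g (freq m q)) := hasSum_ite_eq _ _
  have h2 : HasSum (fun r : ℤ × ℤ => if r = q then (θ (q.2 / m) : ℂ) * fourierCoeff g q.2 else 0)
      (θ (q.2 / m) * fourierCoeff g q.2) := hasSum_ite_eq _ _
  refine ((h1.sub h2).mul_left (lam (freq m q) : ℂ)).congr_fun fun r => ?_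
  by_cases hr : freq m r = freq m q
  · have e1 : r.1 = 0 ↔ r = (0, freq m q) := by
      constructor
      · intro h
        have : freq m r = r.2 := by simp [freq, h]
        rw [← hr, this, ← h]
      · rintro rfl; rfl
    have e2 : (if r = q then (θ (q.2 / m) : ℂ) * fourierCoeff g q.2 else 0)
        = θ (r.2 / m) * fourierCoeff g r.2 := by
      split_ifs with h
      · rw [h]
      · have : ¬ |r.2| ≤ m := fun h' => h (injOn_freq_abs_snd_le m h' hq hr)
        rw [hθ.eq_zero_of_le hm (by omega)]
        simp
    rw [e2, if_pos hr, errCoeff, hr, window]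
    by_cases h : r.1 = 0
    · have h3 : r.2 = freq m q := by rw [e1.1 h]
      rw [if_pos (e1.1 h), if_pos h, h3]
      push_cast
      ring
    · rw [if_neg (fun h' => h (e1.2 h')), if_neg h]
      push_cast
      ring
  · have e1 : r ≠ q := fun h => hr (by rw [h])
    have e2 : r ≠ (0, freq m q) := fun h => hr (by rw [h]; simp [freq])
    simp [hr, e1, e2]

theorem sum_fourier_node (m : ℕ) (a : ℤ) :
    ∑ l ∈ Finset.range (2 * m + 1), (fourier a (node m l) : ℂ) =
      if (2 * m + 1 : ℤ) ∣ a then 2 * (m : ℂ) + 1 else 0 := by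
  have hM : (2 * m + 1 : ℕ) ≠ 0 := by omega
  set ζ := Complex.exp (2 * Real.pi * Complex.I / (2 * m + 1 : ℕ)) with hζ
  have hprim : IsPrimitiveRoot ζ (2 * m + 1) := Complex.isPrimitiveRoot_exp _ hM
  have hM' : (2 * (m : ℂ) + 1) ≠ 0 := by exact_mod_cast hM
  have hpi : (Real.pi : ℂ) ≠ 0 := by exact_mod_cast Real.pi_ne_zero
  have e : ∀ l : ℕ, (fourier a (node m l) : ℂ) = (ζ ^ a) ^ l := by
    intro l
    rw [node, fourier_coe_apply, hζ, ← Complex.exp_int_mul, ← Complex.exp_nat_mul]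
    congr 1
    push_cast
    field_simp
  simp_rw [e]
  have hdvd : ζ ^ a = 1 ↔ (2 * m + 1 : ℤ) ∣ a := by
    rw [hprim.zpow_eq_one_iff_dvd]; push_cast; rfl
  split_ifs with h
  · rw [hdvd.2 h]; simp
  · have hne : ζ ^ a ≠ 1 := fun h' => h (hdvd.1 h')
    rw [geom_sum_eq hne, ← zpow_natCast, ← zpow_mul, mul_comm, zpow_mul, zpow_natCast,
      hprim.pow_eq_one]
    simp

theorem opV_apply {lam θ : ℝ → ℝ} {m : ℕ} (hθ : IsCutoff θ) (hm : 1 ≤ m) (h0 : ∀ x, lam x ≠ 0)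
    {g : Torus → ℂ} (hg : Integrable g torusMeasure) (x : Torus) :
    opV lam lam θ m g x =
      ∑ j ∈ Finset.Icc (-m : ℤ) m, (θ (j / m) : ℂ) * fourierCoeff g j * fourier j x := by
  have hk : ∀ s, kernelH lam lam θ m s = ∑ j ∈ Finset.Icc (-m : ℤ) m, (θ (j / m) : ℂ) * fourier j s := by
    intro s
    rw [kernelH, tsum_eq_sum (s := Finset.Icc (-m : ℤ) m)]
    · refine Finset.sum_congr rfl fun j _ => ?_
      rw [div_self (h0 _), mul_one]
    · intro j hj
      rw [Finset.mem_Icc, ← abs_le] at hj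
      rw [hθ.eq_zero_of_le hm (by omega)]
      simp
  have e : ∀ t, kernelH lam lam θ m (x - t) * g t = ∑ j ∈ Finset.Icc (-m : ℤ) m,
      ((θ (j / m) : ℂ) * fourier j x) * (fourier (-j) t • g t) := by
    intro t
    rw [hk, Finset.sum_mul]
    refine Finset.sum_congr rfl fun j _ => ?_
    rw [fourier_sub_apply, smul_eq_mul]
    ring
  simp_rw [opV, e]
  rw [integral_finsetSum _ fun j _ => (hg.fourier_smul _).const_mul _]
  refine Finset.sum_congr rfl fun j _ => ?_
  rw [integral_const_mul, fourierCoeff]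
  ring

/-- Aliasing: the sum over the nodes annihilates every `j` in `[-m, m]` except the one congruent to
`k` modulo `2m + 1`. -/
theorem opQ_freq {lam θ : ℝ → ℝ} {m : ℕ} (hθ : IsCutoff θ) (hm : 1 ≤ m) (h0 : ∀ x, lam x ≠ 0)
    {g : Torus → ℂ} (hg : Integrable g torusMeasure) {q : ℤ × ℤ} (hq : |q.2| ≤ m) :
    opQ lam lam θ m g (freq m q) = lam (freq m q) * (θ (q.2 / m) * fourierCoeff g q.2) := by
  set k := freq m q with hk
  have hM' : (2 * (m : ℂ) + 1) ≠ 0 := by exact_mod_cast (by omega : (2 * m + 1 : ℕ) ≠ 0)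
  have h1 : ∑ l ∈ Finset.range (2 * m + 1), opV lam lam θ m g (node m l) *
      ((fourier k (-node m l) : ℂ) * lam k) =
      lam k * ∑ j ∈ Finset.Icc (-m : ℤ) m, (θ (j / m) : ℂ) * fourierCoeff g j *
        ∑ l ∈ Finset.range (2 * m + 1), (fourier (j - k) (node m l) : ℂ) := by
    simp_rw [opV_apply hθ hm h0 hg, Finset.mul_sum, Finset.sum_mul]
    rw [Finset.sum_comm]
    refine Finset.sum_congr rfl fun j _ => Finset.sum_congr rfl fun l _ => ?_
    have : (fourier k (-node m l) : ℂ) = fourier (-k) (node m l) := by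
      simp [fourier_apply]
    rw [this, sub_eq_add_neg, fourier_add]
    ring
  have h2 : ∑ j ∈ Finset.Icc (-m : ℤ) m, (θ (j / m) : ℂ) * fourierCoeff g j *
        ∑ l ∈ Finset.range (2 * m + 1), (fourier (j - k) (node m l) : ℂ) =
      θ (q.2 / m) * fourierCoeff g q.2 * (2 * m + 1) := by
    simp_rw [sum_fourier_node]
    rw [Finset.sum_eq_single q.2]
    · rw [if_pos]
      exact ⟨-q.1, by rw [hk, freq]; ring⟩
    · intro j hj hne
      rw [if_neg, mul_zero]
      rintro ⟨n, hn⟩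
      rw [Finset.mem_Icc, ← abs_le] at hj
      have : freq m (-n, j) = freq m q := by
        rw [← hk]; simp only [freq]; linarith
      exact hne (by rw [← injOn_freq_abs_snd_le m (show |((-n, j) : ℤ × ℤ).2| ≤ m from hj) hq this])
    · intro h
      rw [Finset.mem_Icc, ← abs_le] at h
      exact absurd hq h
  simp only [opQ, Pi.smul_apply, Finset.sum_apply, translate, phi, smul_eq_mul]
  rw [h1, h2]
  field_simp

/-! ### From kernel bounds to norm bounds -/

theorem distrNorm_le_of_enorm_errKernel_le {lam θ : ℝ → ℝ} {m : ℕ} (hθ : IsCutoff θ) (hm : 1 ≤ m)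
    (h0 : ∀ x, lam x ≠ 0) {p : ℝ≥0∞} (hp : 1 ≤ p)
    (hs : Summable fun q => |errCoeff lam θ m q|) {P : Torus → ℝ≥0∞} (hP : Measurable P)
    (hPint : ∫⁻ s, P s ∂torusMeasure ≠ ∞) (hK : ∀ s x, ‖errKernel lam θ m s x‖ₑ ≤ P s)
    {f g : Torus → ℂ} (hfg : Represents lam p f g) :
    distrNorm p (ofFun f - opQ lam lam θ m g) ≤
      (∫⁻ s, P s ∂torusMeasure) * eLpNorm g p torusMeasure := by
  obtain ⟨hg, hf⟩ := hfg
  have hgi : Integrable g torusMeasure := hg.integrable hp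
  have hle : eLpNorm (errFun lam θ m g) p torusMeasure ≤
      (∫⁻ s, P s ∂torusMeasure) * eLpNorm g p torusMeasure := by
    refine eLpNorm_le_of_enorm_le_convolution hp hP hg.1 fun x => ?_
    rw [errFun_eq_integral hs hgi]
    refine (enorm_integral_le_lintegral_enorm _).trans (lintegral_mono fun t => ?_)
    rw [enorm_mul]
    exact mul_le_mul_left (hK _ _) _
  refine iInf_le_of_le (errFun lam θ m g) (iInf_le_of_le ?_ (iInf_le_of_le ?_ hle))
  · exact ⟨(continuous_errFun hs g).aestronglyMeasurable,
      hle.trans_lt (ENNReal.mul_lt_top hPint.lt_top hg.2)⟩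
  · funext k
    obtain ⟨q, hq, rfl⟩ := exists_freq_eq m k
    rw [Pi.sub_apply, hf, opQ_freq hθ hm h0 hgi hq, ofFun, fourierCoeff_errFun hθ hm hs g hq]
    simp only [conv, phi, ofFun]
    ring

/-- The bound with a constant depending on `m`. -/
theorem exists_bound_of_functionalJ_ne_top {lam θ : ℝ → ℝ} {m : ℕ} (hlam : IsMonotoneType lam)
    (hθ : IsCutoff θ) (hm : 1 ≤ m) (h0 : ∀ x, lam x ≠ 0) {p : ℝ≥0∞} (hp : 1 ≤ p)
    (hJ : functionalJ m lam ≠ ∞) :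
    ∃ b : ℝ, 0 ≤ b ∧ ∀ f g, Represents lam p f g →
      distrNorm p (ofFun f - opQ lam lam θ m g) ≤
        ENNReal.ofReal b * functionalJ m lam * eLpNorm g p torusMeasure := by
  have hs := summable_errCoeff (summable_of_functionalJ_ne_top hlam hm hJ) hθ hm
  set A := ∑' q, ENNReal.ofReal |errCoeff lam θ m q| with hA
  have hAt : A ≠ ∞ := hs.tsum_ofReal_ne_top
  have hJ0 := functionalJ_pos hlam.1 h0 hm
  -- `A` bounds the kernel everywhere; dividing by `J_m` is legitimate because it is neither `0` nor
  -- `∞`.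
  refine ⟨(A / functionalJ m lam).toReal, ENNReal.toReal_nonneg, fun f g hfg => ?_⟩
  rw [ENNReal.ofReal_toReal (ENNReal.div_ne_top hAt hJ0), ENNReal.div_mul_cancel hJ0 hJ]
  have := distrNorm_le_of_enorm_errKernel_le hθ hm h0 hp hs (P := fun _ => A) measurable_const
    (by simpa using hAt) (fun s x => enorm_errKernel_le lam θ m s x) hfg
  simpa using this

/-- The bound with a uniform constant for large `m`. -/
theorem exists_bound_of_large {lam θ : ℝ → ℝ} (hlam : IsMonotoneType lam)
    (hθ : IsCutoff θ) (h0 : ∀ x, lam x ≠ 0) {p : ℝ≥0∞} (hp : 1 ≤ p) :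
    ∃ D : ℝ, 0 < D ∧ ∃ m₀ : ℕ, ∀ m, m₀ ≤ m → 1 ≤ m → functionalJ m lam ≠ ∞ →
      ∀ f g, Represents lam p f g → distrNorm p (ofFun f - opQ lam lam θ m g) ≤
        ENNReal.ofReal D * functionalJ m lam * eLpNorm g p torusMeasure := by
  obtain ⟨D, hD, m₀, hbound⟩ := exists_err_sum_le hlam hθ
  refine ⟨D * (Real.pi / 4), by positivity, m₀, fun m hm0 hm hJ f g hfg => ?_⟩
  have hs := summable_errCoeff (summable_of_functionalJ_ne_top hlam hm hJ) hθ hm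
  set S := ∑' q, ENNReal.ofReal (|errDiff lam θ m q| + |errCoeff lam θ m q| / (m : ℝ) ^ 2) with hS
  have hm0' : (0 : ℝ) < m := by positivity
  have hle : ∫⁻ s, S * peak m s ∂torusMeasure ≤
      ENNReal.ofReal (D * (Real.pi / 4)) * functionalJ m lam := by
    rw [lintegral_const_mul _ (measurable_peak m)]
    calc _ ≤ ENNReal.ofReal (D / m) * functionalJ m lam * ENNReal.ofReal (Real.pi / 4 * m) :=
          mul_le_mul' (hbound m hm0) (lintegral_peak_le hm)
      _ = ENNReal.ofReal (D / m * (Real.pi / 4 * m)) * functionalJ m lam := by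
          rw [ENNReal.ofReal_mul (p := D / m) (by positivity)]; ring
      _ = _ := by
          congr 2
          field_simp
  refine (distrNorm_le_of_enorm_errKernel_le hθ hm h0 hp hs ((measurable_peak m).const_mul S)
    (ne_top_of_le_ne_top (ENNReal.mul_ne_top ENNReal.ofReal_ne_top hJ) hle)
    (fun s x => enorm_errKernel_le_peak hm hs s x) hfg).trans ?_
  gcongr

theorem Represents.ofFun_eq {lam : ℝ → ℝ} (h0 : ∀ x, lam x ≠ 0) {p : ℝ≥0∞} {f g g' : Torus → ℂ}
    (h : Represents lam p f g) (h' : Represents lam p f g') : fourierCoeff g = fourierCoeff g' := by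
  funext k
  have := congrFun (h.2.symm.trans h'.2) k
  simp only [conv, phi, ofFun] at this
  exact mul_left_cancel₀ (by exact_mod_cast h0 k) this

/-- Working with Fourier coefficients lets representatives of `f` be interchanged without proving
that they agree almost everywhere. -/
theorem opQ_congr {lam θ : ℝ → ℝ} {m : ℕ} (hθ : IsCutoff θ) (hm : 1 ≤ m) (h0 : ∀ x, lam x ≠ 0)
    {g g' : Torus → ℂ} (hg : Integrable g torusMeasure) (hg' : Integrable g' torusMeasure)
    (h : fourierCoeff g = fourierCoeff g') : opQ lam lam θ m g = opQ lam lam θ m g' := by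
  funext k
  obtain ⟨q, hq, rfl⟩ := exists_freq_eq m k
  rw [opQ_freq hθ hm h0 hg hq, opQ_freq hθ hm h0 hg' hq, h]

theorem fourierCoeff_eq_zero_of_hNorm_eq_zero {lam : ℝ → ℝ} (h0 : ∀ x, lam x ≠ 0) {p : ℝ≥0∞}
    (hp : 1 ≤ p) {f g : Torus → ℂ} (hfg : Represents lam p f g) (h : hNorm lam p f = 0) (k : ℤ) :
    fourierCoeff g k = 0 := by
  have hle : ‖fourierCoeff g k‖ₑ ≤ hNorm lam p f := by
    refine le_iInf fun g' => le_iInf fun hg' => ?_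
    rw [hfg.ofFun_eq h0 hg']
    refine (enorm_integral_le_lintegral_enorm _).trans ?_
    refine le_trans (le_of_eq ?_) (eLpNorm_le_eLpNorm_of_exponent_le hp hg'.1.1)
    rw [eLpNorm_one_eq_lintegral_enorm]
    congr 1 with t
    rw [enorm_smul, ← ofReal_norm (fourier (-k) t : ℂ), norm_fourier_apply]
    simp
  simpa [h] using hle

end TorusApprox

end

theorem mainTheorem8 (p : ENNReal) (hp : 1 ≤ p)
    (θ : ℝ → ℝ) (hθ : TorusApprox.IsCutoff θ)
    (lam : ℝ → ℝ) (hlam_ne : ∀ x, lam x ≠ 0) (hlam_bdd : ∃ B : ℝ, ∀ x, |lam x| ≤ B)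
    (hlam : TorusApprox.IsMonotoneType lam) :
    ∃ c : ℝ, 0 < c ∧
      ∀ f ∈ TorusApprox.hSpace lam p, ∀ g, TorusApprox.Represents lam p f g →
        ∀ m : ℕ, 1 ≤ m →
          TorusApprox.distrNorm p
              (TorusApprox.ofFun f - TorusApprox.opQ lam lam θ m g) ≤
            ENNReal.ofReal c * TorusApprox.functionalJ m lam * TorusApprox.hNorm lam p f := by
  open TorusApprox MeasureTheory in
  obtain ⟨D, hD, m₀, hlarge⟩ := exists_bound_of_large hlam hθ hlam_ne hp
  have hsmall : ∀ m : ℕ, ∃ b : ℝ, 0 ≤ b ∧ (1 ≤ m → functionalJ m lam ≠ ⊤ → ∀ f g,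
      Represents lam p f g → distrNorm p (ofFun f - opQ lam lam θ m g) ≤
        ENNReal.ofReal b * functionalJ m lam * eLpNorm g p torusMeasure) := by
    intro m
    by_cases h : 1 ≤ m ∧ functionalJ m lam ≠ ⊤
    · obtain ⟨b, hb, hb'⟩ := exists_bound_of_functionalJ_ne_top hlam hθ h.1 hlam_ne hp h.2
      exact ⟨b, hb, fun _ _ => hb'⟩
    · exact ⟨0, le_rfl, fun h1 h2 => absurd ⟨h1, h2⟩ h⟩
  choose b hb hbound using hsmall
  have hsum : 0 ≤ ∑ m ∈ Finset.range m₀, b m := Finset.sum_nonneg fun m _ => hb m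
  refine ⟨D + ∑ m ∈ Finset.range m₀, b m, by positivity, fun f hf g hfg m hm => ?_⟩
  set c := D + ∑ m ∈ Finset.range m₀, b m with hc
  have hc0 : ENNReal.ofReal c ≠ 0 := by
    rw [← pos_iff_ne_zero, ENNReal.ofReal_pos]; positivity
  have hgi := hfg.1.integrable hp
  have hJ0 := functionalJ_pos hlam.1 hlam_ne hm
  by_cases hJ : functionalJ m lam = ⊤
  -- With `J_m = ∞` the right side is `∞ · 0 = 0` when `hNorm` vanishes, so the error must be shown
  -- to be the zero distribution; otherwise it is `∞`.
  · by_cases hN : hNorm lam p f = 0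
    · have hg0 := fourierCoeff_eq_zero_of_hNorm_eq_zero hlam_ne hp hfg hN
      have hzero : ofFun f - opQ lam lam θ m g = ofFun 0 := by
        funext k
        obtain ⟨q, hq, rfl⟩ := exists_freq_eq m k
        rw [Pi.sub_apply, hfg.2, opQ_freq hθ hm hlam_ne hgi hq]
        simp only [conv, ofFun, hg0]
        simp [fourierCoeff]
      rw [hN, mul_zero, hzero]
      exact iInf_le_of_le 0 (iInf_le_of_le MemLp.zero (iInf_le_of_le rfl (by simp)))
    · rw [hJ, ENNReal.mul_top hc0, ENNReal.top_mul hN]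
      exact le_top
  -- `hNorm` is an infimum over representatives, so the bound is proved for each `g'` and the finite
  -- nonzero factor is then moved inside the infimum.
  · have hall : ∀ g', Represents lam p f g' → distrNorm p (ofFun f - opQ lam lam θ m g) ≤
        ENNReal.ofReal c * functionalJ m lam * eLpNorm g' p torusMeasure := by
      intro g' hg'
      rw [opQ_congr hθ hm hlam_ne hgi (hg'.1.integrable hp) (hfg.ofFun_eq hlam_ne hg')]
      by_cases h : m₀ ≤ m
      · refine (hlarge m h hm hJ f g' hg').trans ?_
        gcongr
        linarith
      · refine (hbound m hm hJ f g' hg').trans ?_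
        gcongr
        have := Finset.single_le_sum (fun i _ => hb i) (Finset.mem_range.2 (not_le.1 h))
        linarith
    have ha0 := mul_ne_zero hc0 hJ0
    have hat := ENNReal.mul_ne_top (ENNReal.ofReal_ne_top (r := c)) hJ
    rw [hNorm, ENNReal.mul_iInf_of_ne ha0 hat]
    refine le_iInf fun g' => ?_
    rw [ENNReal.mul_iInf_of_ne ha0 hat]
    exact le_iInf fun hg' => hall g' hg'
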